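/- Let $\mathcal{M}$ be a von Neumann algebra acting on a separable complex Hilbert space $\mathcal{H}$, and let $\tau$ be a normal faithful finite tracial state on $\mathcal{M}$, that is, an additive, positively homogeneous map $\tau:\mathcal{M}^+\to[0,\infty]$ that is faithful ($\tau(x^*x)=0$ implies $x=0$), normal ($\tau$ preserves suprema of bounded increasing nets in $\mathcal{M}^+$), tracial ($\tau(x^*x)=\tau(xx^*)$ for all $x\in\mathcal{M}$), and satisfies $\tau(\mathbb{I})=1$. For $x\in\mathcal{M}$ and $t>0$ put $$\mu_t(x)=\inf\{\|xe\|: e\in\mathcal{M}\text{ a projection},\ \tau(\mathbb{I}-e)\le t\},\qquad \mu_t^\ell(x)=\inf\{\|xe\|: e\in\mathcal{M}\text{ a projection},\ \tau(\mathbb{I}-e)<t\}.$$ For self-adjoint $y\in\mathcal{M}$ and $0<t<1$ let $$\lambda_t(y)=\inf\{s\in\mathbb{R}:\tau(\mathbb{I}-e_s(y))\le t\}$$ be its spectral scale, where $e_s(y)=e_{(-\infty,s]}(y)$ is the spectral projection of $y$ for the interval $(-\infty,s]$. Write $\operatorname{Re}x=\frac{x+x^*}{2}$ and $\operatorname{Im}x=\frac{x-x^*}{2i}$.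 Then for every $x\in\mathcal{M}$ and every $0<s<1$, $$-\mu_{1-s}^\ell(x)\le\lambda_s(\operatorname{Re}x)\le\mu_s(x)\qquad\text{and}\qquad -\mu_{1-s}^\ell(x)\le\lambda_s(\operatorname{Im}x)\le\mu_s(x).$$ -/

import Mathlib

open scoped ENNReal NNReal ComplexStarModule

namespace VonNeumannAlgebra

variable {H : Type*} [NormedAddCommGroup H] [InnerProductSpace ℂ H] [CompleteSpace H]

/-- The algebra of elements of `M`, with its `*`-algebra structure and the operator norm. -/
abbrev Elem (M : VonNeumannAlgebra H) : Type _ := M.toStarSubalgebra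

/-- The positive part `M⁺`: elements of `M` that are positive operators on `H`. -/
abbrev Pos (M : VonNeumannAlgebra H) : Type _ := {x : M.Elem // 0 ≤ (x : H →L[ℂ] H)}

/-- The projections of `M`. -/
abbrev Proj (M : VonNeumannAlgebra H) : Type _ := {e : M.Elem // IsStarProjection e}

variable {M : VonNeumannAlgebra H}

theorem Proj.isStarProjection_coe (e : M.Proj) :
    IsStarProjection ((e : M.Elem) : H →L[ℂ] H) :=
  ⟨congrArg Subtype.val e.2.isIdempotentElem, congrArg Subtype.val e.2.isSelfAdjoint⟩

/-- The complement `e^⊥ = 1 - e` of a projection of `M`, as an element of `M⁺`. -/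
noncomputable def Proj.compl (e : M.Proj) : M.Pos :=
  ⟨1 - e.1, e.isStarProjection_coe.one_sub.nonneg⟩

namespace Pos

noncomputable instance : Add M.Pos := ⟨fun x y => ⟨x.1 + y.1, add_nonneg x.2 y.2⟩⟩

noncomputable instance : SMul ℝ≥0 M.Pos :=
  ⟨fun a x => ⟨((a : ℝ) : ℂ) • x.1, by
    have h : (0 : H →L[ℂ] H) ≤ (a : ℝ) • ((x.1 : M.Elem) : H →L[ℂ] H) :=
      smul_nonneg a.2 x.2
    exact h⟩⟩

noncomputable instance : One M.Pos := ⟨⟨1, (IsStarProjection.one (H →L[ℂ] H)).nonneg⟩⟩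

/-- `x* x` as an element of `M⁺`. -/
noncomputable def starMul (x : M.Elem) : M.Pos := ⟨star x * x, star_mul_self_nonneg (x : H →L[ℂ] H)⟩

end Pos

/-- A weight on `M`: an additive and positively homogeneous map `M⁺ → [0, ∞]`. -/
structure Weight (M : VonNeumannAlgebra H) where
  toFun : M.Pos → ℝ≥0∞
  map_add' : ∀ x y : M.Pos, toFun (x + y) = toFun x + toFun y
  map_smul' : ∀ (a : ℝ≥0) (x : M.Pos), toFun (a • x) = (a : ℝ≥0∞) * toFun x

namespace Weight

instance : CoeFun M.Weight (fun _ => M.Pos → ℝ≥0∞) := ⟨Weight.toFun⟩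

/-- `τ(x* x) = 0` implies `x = 0`. -/
def IsFaithful (τ : M.Weight) : Prop :=
  ∀ x : M.Elem, τ (Pos.starMul x) = 0 → x = 0

/-- `τ` preserves suprema of upward directed families in `M⁺`. -/
def IsNormal (τ : M.Weight) : Prop :=
  ∀ (S : Set M.Pos) (x : M.Pos), S.Nonempty → DirectedOn (· ≤ ·) S → IsLUB S x →
    IsLUB (τ '' S) (τ x)

/-- `τ(x* x) = τ(x x*)`. -/
def IsTracial (τ : M.Weight) : Prop :=
  ∀ x : M.Elem, τ (Pos.starMul x) = τ (Pos.starMul (star x))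

/-- A faithful normal tracial state: a faithful normal tracial weight with `τ(1) = 1`. -/
structure IsFaithfulNormalTracialState (τ : M.Weight) : Prop where
  faithful : τ.IsFaithful
  normal : τ.IsNormal
  tracial : τ.IsTracial
  map_one : τ 1 = 1

end Weight

/-- The operator `(x - s)₊`, i.e. `f(x)` for `f(t) = max (t - s) 0` (continuous functional
calculus of the self-adjoint operator `x`). -/
noncomputable def cutAbove (x : selfAdjoint M.Elem) (s : ℝ) : H →L[ℂ] H :=
  cfc (fun t : ℝ => max (t - s) 0) ((x : M.Elem) : H →L[ℂ] H)

/-- The spectral projection `e_{(-∞, s]}(x)` as an operator on `H`: the orthogonal projection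
onto the kernel of `(x - s)₊`. As `f(t) = max (t - s) 0` vanishes exactly on `(-∞, s]`, this is
the value at `s` of the right-continuous spectral resolution of `x`. -/
noncomputable def spectralProjOp (x : selfAdjoint M.Elem) (s : ℝ) : H →L[ℂ] H :=
  haveI : CompleteSpace (cutAbove x s).ker := (cutAbove x s).isClosed_ker.completeSpace_coe
  (cutAbove x s).ker.starProjection

theorem isStarProjection_spectralProjOp (x : selfAdjoint M.Elem) (s : ℝ) :
    IsStarProjection (spectralProjOp x s) := by
  have : CompleteSpace (cutAbove x s).ker := (cutAbove x s).isClosed_ker.completeSpace_coe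
  exact isStarProjection_starProjection

theorem spectralProjOp_mem (x : selfAdjoint M.Elem) (s : ℝ) :
    spectralProjOp x s ∈ M.toStarSubalgebra := by
  have : CompleteSpace (cutAbove x s).ker := (cutAbove x s).isClosed_ker.completeSpace_coe
  change spectralProjOp x s ∈ M
  rw [IsStarProjection.mem_iff (isStarProjection_spectralProjOp x s)]
  intro y hy
  have hxy : Commute ((x : M.Elem) : H →L[ℂ] H) y :=
    (mem_commutant_iff.1 hy) _ x.1.2
  have hc : Commute (cutAbove x s) y := hxy.cfc_real _
  have hr : (spectralProjOp x s).range = (cutAbove x s).ker :=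
    Submodule.range_starProjection _
  rw [hr]
  intro v hv
  have h1 : (cutAbove x s) v = 0 := hv
  have h2 : cutAbove x s (y v) = y (cutAbove x s v) := congrArg (fun T => T v) hc.eq
  change cutAbove x s (y v) = 0
  rw [h2, h1, map_zero]

/-- The spectral projection `e_s(x) = e_{(-∞, s]}(x)` of `x ∈ M^{sa}`, as a projection of `M`. -/
noncomputable def spectralProj (x : selfAdjoint M.Elem) (s : ℝ) : M.Proj :=
  ⟨⟨spectralProjOp x s, spectralProjOp_mem x s⟩,
    ⟨Subtype.ext (isStarProjection_spectralProjOp x s).isIdempotentElem,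
      Subtype.ext (isStarProjection_spectralProjOp x s).isSelfAdjoint⟩⟩

/-- The spectral scale `λ_t(x) = inf {s ∈ ℝ : τ(1 - e_s(x)) ≤ t}` of `x ∈ M^{sa}`
(meant for `0 < t < τ(1)`). -/
noncomputable def spectralScale (τ : M.Weight) (t : ℝ) (x : selfAdjoint M.Elem) : ℝ :=
  sInf {s : ℝ | τ (spectralProj x s).compl ≤ ENNReal.ofReal t}

/-- The generalized singular number
`μ_t(x) = inf {‖x e‖ : e a projection of M with τ(e^⊥) ≤ t}` (meant for `t > 0`). -/
noncomputable def singularNumber (τ : M.Weight) (t : ℝ) (x : M.Elem) : ℝ :=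
  sInf {r : ℝ | ∃ e : M.Proj, τ e.compl ≤ ENNReal.ofReal t ∧ r = ‖x * e.1‖}

/-- The left-continuous variant
`μ_t^ℓ(x) = inf {‖x e‖ : e a projection of M with τ(e^⊥) < t}` (meant for `t > 0`). -/
noncomputable def singularNumberLeft (τ : M.Weight) (t : ℝ) (x : M.Elem) : ℝ :=
  sInf {r : ℝ | ∃ e : M.Proj, τ e.compl < ENNReal.ofReal t ∧ r = ‖x * e.1‖}

end VonNeumannAlgebra

/-!
The heart of the matter is a comparison of projections `p`, `q` of `M`: if the range of `p` meets
the range of `1 - q` only in `0`, then `τ p ≤ τ q` (`Weight.toPos_le_toPos_of_ker`). Morally `p` is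
then equivalent to a subprojection of `q`, through the polar decomposition of `y = q p`. The partial
isometry itself is not needed: `z = y (max (y* y) ε)^(-1/2)` is a contraction with `q z = z`, so
`τ (z* z) = τ (z z*) ≤ τ q`, and `z* z` increases to the support projection `p` of `y* y` as
`ε ↓ 0`, so normality gives `τ p ≤ τ q`. The monotone convergence to the support is
`le_of_forall_supportApprox_le`.

Let `y` be the real or imaginary part of `x`, so that `|⟨y v, v⟩| ≤ ‖x v‖ ‖v‖`, and let `e` be a
projection with `r = ‖x e‖`. On the range of `e` the quadratic form of `y` lies between `-r ‖v‖²`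
and `r ‖v‖²`. On the range of `1 - e_r(y)` it is greater than `r ‖v‖²` for `v ≠ 0`, so this range
meets that of `e` trivially and `τ (1 - e_r(y)) ≤ τ (1 - e)`; this gives the upper bound on the
spectral scale. For `t < -r` the form is at most `t ‖v‖²` on the range of `e_t(y)`, so in the same
way `τ (e_t(y)) ≤ τ (1 - e)`, which is incompatible with `τ (1 - e_t(y)) ≤ s` and
`τ (1 - e) < 1 - s`; this gives the lower bound. The lower bound also shows that the set whose
infimum is the spectral scale is bounded below, so that the infimum is a genuine one.
-/

namespace VonNeumannAlgebra

variable {H : Type*} [NormedAddCommGroup H] [InnerProductSpace ℂ H] [CompleteSpace H]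

/-! ### Approximating the support projection of a positive operator -/

/-- The operator `f_ε(a)` for `f_ε(t) = t / max t ε`. For `a ≥ 0` and `ε ↓ 0` these operators
increase to the projection onto the closure of the range of `a`. -/
noncomputable def supportApprox (ε : ℝ) (a : H →L[ℂ] H) : H →L[ℂ] H :=
  cfc (fun t : ℝ => t / max t ε) a

theorem continuous_inv_max {ε : ℝ} (hε : 0 < ε) : Continuous fun t : ℝ => (max t ε)⁻¹ :=
  (continuous_id.max continuous_const).inv₀ fun _ => (lt_max_of_lt_right hε).ne'

theorem continuous_div_max {ε : ℝ} (hε : 0 < ε) : Continuous fun t : ℝ => t / max t ε :=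
  continuous_id.mul (continuous_inv_max hε)

theorem supportApprox_nonneg {ε : ℝ} (hε : 0 < ε) {a : H →L[ℂ] H} (ha : 0 ≤ a) :
    0 ≤ supportApprox ε a :=
  cfc_nonneg fun _ ht =>
    div_nonneg (spectrum_nonneg_of_nonneg ha ht) (lt_max_of_lt_right hε).le

theorem supportApprox_le_one {ε : ℝ} (hε : 0 < ε) (a : H →L[ℂ] H) :
    supportApprox ε a ≤ 1 :=
  cfc_le_one _ _ fun _ _ => (div_le_one (lt_max_of_lt_right hε)).2 (le_max_left _ ε)

theorem supportApprox_anti {δ ε : ℝ} (hδ : 0 < δ) (hδε : δ ≤ ε) {a : H →L[ℂ] H} (ha : 0 ≤ a) :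
    supportApprox ε a ≤ supportApprox δ a :=
  cfc_mono (fun _ ht => div_le_div_of_nonneg_left (spectrum_nonneg_of_nonneg ha ht)
      (lt_max_of_lt_right hδ) (max_le_max le_rfl hδε))
    (continuous_div_max (hδ.trans_le hδε)).continuousOn (continuous_div_max hδ).continuousOn

theorem supportApprox_eq_mul {ε : ℝ} (hε : 0 < ε) {a : H →L[ℂ] H} (ha : IsSelfAdjoint a) :
    supportApprox ε a = cfc (fun t : ℝ => (max t ε)⁻¹) a * a := by
  conv_rhs => arg 2; rw [← cfc_id ℝ a]
  rw [← cfc_mul _ _ a (continuous_inv_max hε).continuousOn continuousOn_id]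
  simp only [supportApprox, div_eq_inv_mul, id]

theorem norm_supportApprox_mul_sub_le {ε : ℝ} (hε : 0 < ε) {a : H →L[ℂ] H} (ha : 0 ≤ a) :
    ‖supportApprox ε a * a - a‖ ≤ ε := by
  have hsa : IsSelfAdjoint a := IsSelfAdjoint.of_nonneg ha
  have h : supportApprox ε a * a - a = cfc (fun t : ℝ => t / max t ε * t - t) a := by
    rw [cfc_sub (fun t : ℝ => t / max t ε * t) (fun t : ℝ => t) a
        ((continuous_div_max hε).mul continuous_id).continuousOn continuousOn_id,
      cfc_mul (fun t : ℝ => t / max t ε) (fun t : ℝ => t) a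
        (continuous_div_max hε).continuousOn continuousOn_id, cfc_id' ℝ a]
    rfl
  rw [h]
  refine norm_cfc_le hε.le fun t ht => ?_
  have ht0 : 0 ≤ t := spectrum_nonneg_of_nonneg ha ht
  rw [Real.norm_eq_abs]
  rcases le_total ε t with h1 | h1
  · rw [max_eq_left h1, div_self (hε.trans_le h1).ne']
    simpa using hε.le
  · rw [max_eq_right h1]
    have h2 : t / ε ≤ 1 := (div_le_one hε).2 h1
    have h3 : 0 ≤ t / ε := div_nonneg ht0 hε.le
    rw [abs_le]
    constructor <;> nlinarith

/-- A projection `p` with the same kernel as `a ≥ 0` lies below every self-adjoint upper bound of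
the operators `f_ε(a)`. The inequality of quadratic forms is tested on the dense subspace
`ran a + ker a`. -/
theorem le_of_forall_supportApprox_le {a p c : H →L[ℂ] H} (ha : 0 ≤ a) (hp : IsStarProjection p)
    (hap : a * p = a) (hker : ∀ v, a v = 0 → p v = 0) (hc : IsSelfAdjoint c)
    (h : ∀ ε : ℝ, 0 < ε → supportApprox ε a ≤ c) : p ≤ c := by
  have hsa : IsSelfAdjoint a := IsSelfAdjoint.of_nonneg ha
  have hpa : p * a = a := by
    have := congrArg star hap
    rwa [star_mul, hsa.star_eq, hp.isSelfAdjoint.star_eq] at this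
  have hdense : Dense ((a.range ⊔ a.ker : Submodule ℂ H) : Set H) := by
    rw [Submodule.dense_iff_topologicalClosure_eq_top, Submodule.topologicalClosure_eq_top_iff,
      ← Submodule.inf_orthogonal, ContinuousLinearMap.orthogonal_range,
      ← ContinuousLinearMap.star_eq_adjoint, hsa.star_eq, Submodule.inf_orthogonal_eq_bot]
  rw [ContinuousLinearMap.le_def, ContinuousLinearMap.isPositive_def']
  refine ⟨hc.sub hp.isSelfAdjoint, fun v => ?_⟩
  have hclosed : IsClosed {v : H | 0 ≤ (c - p).reApplyInnerSelf v} :=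
    isClosed_le continuous_const (ContinuousLinearMap.reApplyInnerSelf_continuous _)
  refine hclosed.closure_subset_iff.2 ?_ (hdense v)
  intro v hv
  obtain ⟨_, ⟨w, rfl⟩, u, hu, rfl⟩ := Submodule.mem_sup.1 hv
  have hu' : a u = 0 := hu
  set v := a w + u with hvdef
  have hpv : p v = a w := by
    have : p (a w) = a w := congrArg (fun T => T w) hpa
    rw [hvdef, map_add, this, hker u hu', add_zero]
  have key : ∀ ε : ℝ, 0 < ε → -(ε * ‖w‖ * ‖v‖) ≤ (c - p).reApplyInnerSelf v := by
    intro ε hε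
    have h1 : 0 ≤ (c - supportApprox ε a).reApplyInnerSelf v :=
      ((ContinuousLinearMap.isPositive_def'.1 ((ContinuousLinearMap.le_def _ _).1 (h ε hε)))).2 v
    have hfv : supportApprox ε a v - p v = (supportApprox ε a * a - a) w := by
      have : supportApprox ε a u = 0 := by
        rw [supportApprox_eq_mul hε hsa, mul_apply_eq_comp, hu', map_zero]
      rw [hpv, hvdef, map_add, this, add_zero]
      rfl
    have h2 : ‖supportApprox ε a v - p v‖ ≤ ε * ‖w‖ := by
      rw [hfv]
      exact ContinuousLinearMap.le_of_opNorm_le _ (norm_supportApprox_mul_sub_le hε ha) w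
    have h3 : (c - p).reApplyInnerSelf v = (c - supportApprox ε a).reApplyInnerSelf v
        + RCLike.re (inner ℂ (supportApprox ε a v - p v) v) := by
      simp only [ContinuousLinearMap.reApplyInnerSelf_apply, sub_apply]
      rw [← map_add, ← inner_add_left]
      congr 2
      abel
    have h4 : |RCLike.re (inner ℂ (supportApprox ε a v - p v) v)| ≤ ε * ‖w‖ * ‖v‖ :=
      (RCLike.abs_re_le_norm _).trans ((norm_inner_le_norm _ _).trans
        (mul_le_mul_of_nonneg_right h2 (norm_nonneg _)))
    rw [h3]
    linarith [neg_le_of_abs_le h4]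
  have hlim : Filter.Tendsto (fun ε : ℝ => -(ε * ‖w‖ * ‖v‖)) (nhdsWithin 0 (Set.Ioi 0))
      (nhds 0) := by
    have : Continuous fun ε : ℝ => -(ε * ‖w‖ * ‖v‖) := by fun_prop
    simpa using (this.tendsto 0).mono_left nhdsWithin_le_nhds
  exact le_of_tendsto hlim (eventually_mem_nhdsWithin.mono key)

/-- The operators `f_ε(y* y)` have the form `z* z` with `z = y g_ε(y* y)` and
`g_ε(t) = (max t ε)^(-1/2)`. -/
theorem star_mul_self_mul_cfc {ε : ℝ} (hε : 0 < ε) (y : H →L[ℂ] H) :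
    star (y * cfc (fun t : ℝ => √(max t ε)⁻¹) (star y * y)) *
      (y * cfc (fun t : ℝ => √(max t ε)⁻¹) (star y * y)) = supportApprox ε (star y * y) := by
  have hsa : IsSelfAdjoint (star y * y) := IsSelfAdjoint.star_mul_self y
  have hg : Continuous fun t : ℝ => √(max t ε)⁻¹ := (continuous_inv_max hε).sqrt
  have hgsa : IsSelfAdjoint (cfc (fun t : ℝ => √(max t ε)⁻¹) (star y * y)) :=
    cfc_predicate _ _
  have hcomm : Commute (cfc (fun t : ℝ => √(max t ε)⁻¹) (star y * y)) (star y * y) :=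
    (Commute.refl (star y * y)).cfc_real _
  have hsq : cfc (fun t : ℝ => √(max t ε)⁻¹) (star y * y) *
      cfc (fun t : ℝ => √(max t ε)⁻¹) (star y * y) =
      cfc (fun t : ℝ => (max t ε)⁻¹) (star y * y) := by
    rw [← cfc_mul _ _ _ hg.continuousOn hg.continuousOn]
    congr 1
    funext t
    exact Real.mul_self_sqrt (inv_nonneg.2 (lt_max_of_lt_right hε).le)
  rw [supportApprox_eq_mul hε hsa, ← hsq, star_mul, hgsa.star_eq, mul_assoc, mul_assoc,
    ← hcomm.eq.symm, ← mul_assoc (star y)]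

theorem mul_star_self_le_one {z : H →L[ℂ] H} (h : star z * z ≤ 1) : z * star z ≤ 1 := by
  have h1 : ‖star z * z‖ ≤ 1 :=
    (CStarAlgebra.norm_le_one_iff_of_nonneg _ (star_mul_self_nonneg z)).2 h
  refine (CStarAlgebra.norm_le_one_iff_of_nonneg _ (mul_star_self_nonneg z)).1 ?_
  rwa [CStarRing.norm_self_mul_star, ← CStarRing.norm_star_mul_self]

theorem mul_star_self_le_of_mul_eq {q z : H →L[ℂ] H} (hq : IsStarProjection q) (hqz : q * z = z)
    (h : star z * z ≤ 1) : z * star z ≤ q := by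
  have h1 := star_right_conjugate_le_conjugate (mul_star_self_le_one h) q
  have h2 : star z * q = star z := by
    have := congrArg star hqz
    rwa [star_mul, hq.isSelfAdjoint.star_eq] at this
  have h3 : q * (z * star z) * q = z * star z := by
    rw [← mul_assoc, hqz, mul_assoc, h2]
  rwa [hq.isSelfAdjoint.star_eq, h3, mul_one, hq.isIdempotentElem.eq] at h1

variable {M : VonNeumannAlgebra H}

theorem cfc_mem {a : H →L[ℂ] H} (ha : a ∈ M) (f : ℝ → ℝ) : cfc f a ∈ M := by
  rw [← M.commutant_commutant, mem_commutant_iff]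
  intro g hg
  have hag : Commute a g := mem_commutant_iff.1 hg a ha
  exact (hag.cfc_real f).symm.eq

/-! ### Positive operators as quadratic forms -/

theorem re_inner_star_mul_self_apply (d : H →L[ℂ] H) (v : H) :
    RCLike.re (inner ℂ ((star d * d) v) v) = ‖d v‖ ^ 2 := by
  rw [ContinuousLinearMap.star_eq_adjoint]
  exact (ContinuousLinearMap.apply_norm_sq_eq_inner_adjoint_left d v).symm

theorem apply_eq_zero_of_re_inner_eq_zero {c : H →L[ℂ] H} (hc : 0 ≤ c) {v : H}
    (h : RCLike.re (inner ℂ (c v) v) = 0) : c v = 0 := by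
  obtain ⟨d, rfl⟩ := CStarAlgebra.nonneg_iff_eq_star_mul_self.1 hc
  rw [re_inner_star_mul_self_apply] at h
  rw [mul_apply_eq_comp, norm_eq_zero.1 (pow_eq_zero_iff two_ne_zero |>.1 h), map_zero]

/-! ### Comparing traces of projections -/

namespace Proj

/-- A projection of `M` as an element of `M⁺`. -/
noncomputable def toPos (e : M.Proj) : M.Pos :=
  ⟨e.1, e.isStarProjection_coe.nonneg⟩

/-- The complement `1 - e` as a projection of `M`. -/
noncomputable def orth (e : M.Proj) : M.Proj :=
  ⟨1 - e.1, e.2.one_sub⟩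

theorem toPos_orth (e : M.Proj) : e.orth.toPos = e.compl := rfl

end Proj

namespace Weight

variable {τ : M.Weight}

theorem mono (τ : M.Weight) {a b : M.Pos} (h : a ≤ b) : τ a ≤ τ b := by
  have hab : 0 ≤ ((b.1 - a.1 : M.Elem) : H →L[ℂ] H) := sub_nonneg.2 h
  have : b = a + ⟨b.1 - a.1, hab⟩ := Subtype.ext (add_sub_cancel a.1 b.1).symm
  rw [this, τ.map_add']
  exact le_self_add

theorem toPos_add_compl (hτ : τ.IsFaithfulNormalTracialState) (e : M.Proj) :
    τ e.toPos + τ e.compl = 1 := by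
  rw [← τ.map_add', ← hτ.map_one]
  exact congrArg τ (Subtype.ext (add_sub_cancel e.1 1))

theorem compl_one (hτ : τ.IsFaithfulNormalTracialState) :
    τ (Proj.compl (⟨1, IsStarProjection.one M.Elem⟩ : M.Proj)) = 0 := by
  have h := toPos_add_compl hτ (⟨1, IsStarProjection.one M.Elem⟩ : M.Proj)
  have h1 : τ (Proj.toPos (⟨1, IsStarProjection.one M.Elem⟩ : M.Proj)) = 1 := hτ.map_one
  rw [h1] at h
  exact ENNReal.add_right_inj ENNReal.one_ne_top |>.1 (h.trans (add_zero 1).symm)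

/-- If the range of `p` meets the range of `1 - q` trivially, then `τ p ≤ τ q`. With `y = q p` the
support of `y* y` is `p`, so that `τ p` is the supremum of the traces of the operators
`f_ε(y* y) = z* z`, while `τ (z* z) = τ (z z*) ≤ τ q` because `z z* ≤ q`. -/
theorem toPos_le_toPos_of_ker (hnormal : τ.IsNormal) (htr : τ.IsTracial) (p q : M.Proj)
    (h : ∀ v : H, (p.1 : H →L[ℂ] H) v = v → (q.1 : H →L[ℂ] H) v = 0 → v = 0) :
    τ p.toPos ≤ τ q.toPos := by
  have hp := p.isStarProjection_coe
  have hq := q.isStarProjection_coe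
  set P : H →L[ℂ] H := (p.1 : H →L[ℂ] H) with hP
  set Q : H →L[ℂ] H := (q.1 : H →L[ℂ] H) with hQ
  set y : M.Elem := q.1 * p.1 with hy
  have hyc : (y : H →L[ℂ] H) = Q * P := rfl
  set a : H →L[ℂ] H := star (y : H →L[ℂ] H) * (y : H →L[ℂ] H) with ha
  have haM : a ∈ M := (star y * y).2
  have ha0 : 0 ≤ a := star_mul_self_nonneg _
  have haP : a * P = a := by
    rw [ha, mul_assoc, hyc, mul_assoc Q, hp.isIdempotentElem.eq]
  have hker : ∀ v, a v = 0 → P v = 0 := by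
    intro v hv
    have hyv : (y : H →L[ℂ] H) v = 0 := by
      have h1 := re_inner_star_mul_self_apply (y : H →L[ℂ] H) v
      rw [← ha, hv, inner_zero_left, map_zero] at h1
      exact norm_eq_zero.1 (pow_eq_zero_iff two_ne_zero |>.1 h1.symm)
    exact h (P v) (congrArg (fun T => T v) hp.isIdempotentElem.eq) hyv
  let F : ℝ → M.Elem := fun ε => ⟨supportApprox ε a, cfc_mem haM _⟩
  let S : Set M.Pos := {w | ∃ ε : ℝ, 0 < ε ∧ (w.1 : H →L[ℂ] H) = supportApprox ε a}
  have hS : ∀ ε : ℝ, ∀ hε : 0 < ε, (⟨F ε, supportApprox_nonneg hε ha0⟩ : M.Pos) ∈ S :=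
    fun ε hε => ⟨ε, hε, rfl⟩
  have hle : ∀ ε : ℝ, 0 < ε → supportApprox ε a ≤ P := by
    intro ε hε
    have h1 := star_right_conjugate_le_conjugate (supportApprox_le_one hε a) P
    have h2 : supportApprox ε a * P = supportApprox ε a := by
      rw [supportApprox_eq_mul hε (IsSelfAdjoint.of_nonneg ha0), mul_assoc, haP]
    have h3 : P * supportApprox ε a = supportApprox ε a := by
      have := congrArg star h2
      rwa [star_mul, hp.isSelfAdjoint.star_eq,
        (IsSelfAdjoint.of_nonneg (supportApprox_nonneg hε ha0)).star_eq] at this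
    rwa [hp.isSelfAdjoint.star_eq, mul_one, h3, h2, hp.isIdempotentElem.eq] at h1
  have hlub : IsLUB S p.toPos := by
    constructor
    · rintro w ⟨ε, hε, hw⟩
      change (w.1 : H →L[ℂ] H) ≤ P
      exact hw.le.trans (hle ε hε)
    · intro c hc
      refine le_of_forall_supportApprox_le ha0 hp haP hker (IsSelfAdjoint.of_nonneg c.2) ?_
      exact fun ε hε => hc (hS ε hε)
  have hdir : DirectedOn (· ≤ ·) S := by
    rintro w ⟨ε, hε, hw⟩ w' ⟨δ, hδ, hw'⟩
    refine ⟨_, hS (min ε δ) (lt_min hε hδ), ?_, ?_⟩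
    · exact hw.le.trans (supportApprox_anti (lt_min hε hδ) (min_le_left _ _) ha0)
    · exact hw'.le.trans (supportApprox_anti (lt_min hε hδ) (min_le_right _ _) ha0)
  refine (hnormal S p.toPos ⟨_, hS 1 one_pos⟩ hdir hlub).2 ?_
  rintro _ ⟨w, ⟨ε, hε, hw⟩, rfl⟩
  let z : M.Elem := y * ⟨cfc (fun t : ℝ => √(max t ε)⁻¹) a, cfc_mem haM _⟩
  have hz : star (z : H →L[ℂ] H) * (z : H →L[ℂ] H) = supportApprox ε a :=
    star_mul_self_mul_cfc hε (y : H →L[ℂ] H)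
  have hwz : w = Pos.starMul z := Subtype.ext (Subtype.ext (hw.trans hz.symm))
  rw [hwz, htr z]
  refine τ.mono ?_
  change star (star (z : H →L[ℂ] H)) * star (z : H →L[ℂ] H) ≤ Q
  rw [star_star]
  refine mul_star_self_le_of_mul_eq hq ?_ (hz.le.trans (supportApprox_le_one hε a))
  change Q * (Q * P * _) = Q * P * _
  rw [← mul_assoc, ← mul_assoc, hq.isIdempotentElem.eq]

end Weight

/-! ### Quadratic forms on spectral subspaces -/

theorem cutAbove_nonneg (y : selfAdjoint M.Elem) (s : ℝ) : 0 ≤ cutAbove y s :=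
  cfc_nonneg fun _ _ => le_max_right _ _

theorem isSelfAdjoint_coe (y : selfAdjoint M.Elem) : IsSelfAdjoint ((y : M.Elem) : H →L[ℂ] H) :=
  congrArg Subtype.val y.2

/-- The negative part `(y - s)₋` of `y - s`, which vanishes on the range of `(y - s)₊`. -/
theorem exists_cutBelow (y : selfAdjoint M.Elem) (s : ℝ) :
    ∃ b : H →L[ℂ] H, 0 ≤ b ∧ b * cutAbove y s = 0 ∧
      ((y : M.Elem) : H →L[ℂ] H) - algebraMap ℝ _ s = cutAbove y s - b := by
  have hsa := isSelfAdjoint_coe y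
  have hc : Continuous fun t : ℝ => max (t - s) 0 := by fun_prop
  have hc' : Continuous fun t : ℝ => max (s - t) 0 := by fun_prop
  refine ⟨cfc (fun t : ℝ => max (s - t) 0) ((y : M.Elem) : H →L[ℂ] H),
    cfc_nonneg fun _ _ => le_max_right _ _, ?_, ?_⟩
  · rw [cutAbove, ← cfc_mul _ _ _ hc'.continuousOn hc.continuousOn]
    convert cfc_const_zero ℝ ((y : M.Elem) : H →L[ℂ] H) using 2
    funext t
    rcases le_total s t with h | h
    · rw [max_eq_right (sub_nonpos.2 h), zero_mul]
    · rw [max_eq_right (sub_nonpos.2 h), mul_zero]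
  · rw [cutAbove, ← cfc_sub _ _ _ hc.continuousOn hc'.continuousOn]
    conv_lhs => rw [← cfc_id' ℝ ((y : M.Elem) : H →L[ℂ] H)]
    rw [← cfc_const s ((y : M.Elem) : H →L[ℂ] H) hsa, ← cfc_sub _ _ _]
    congr 1
    funext t
    rcases le_total s t with h | h
    · rw [max_eq_right (sub_nonpos.2 h), max_eq_left (sub_nonneg.2 h), sub_zero]
    · rw [max_eq_right (sub_nonpos.2 h), max_eq_left (sub_nonneg.2 h), zero_sub, neg_sub]

omit [CompleteSpace H] in
theorem reApplyInnerSelf_eq_add_sub_algebraMap (y : H →L[ℂ] H) (s : ℝ) (v : H) :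
    y.reApplyInnerSelf v = s * ‖v‖ ^ 2 + (y - algebraMap ℝ _ s).reApplyInnerSelf v := by
  have h : (algebraMap ℝ (H →L[ℂ] H) s) v = (s : ℂ) • v := rfl
  simp only [ContinuousLinearMap.reApplyInnerSelf_apply, sub_apply, h, inner_sub_left,
    inner_smul_left, map_sub, inner_self_eq_norm_sq_to_K]
  simp [← Complex.ofReal_pow]

theorem spectralProjOp_apply_eq_self_iff (y : selfAdjoint M.Elem) (s : ℝ) (v : H) :
    spectralProjOp y s v = v ↔ cutAbove y s v = 0 := by
  have : CompleteSpace (cutAbove y s).ker := (cutAbove y s).isClosed_ker.completeSpace_coe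
  exact Submodule.starProjection_eq_self_iff

theorem spectralProjOp_apply_eq_zero_iff (y : selfAdjoint M.Elem) (s : ℝ) (v : H) :
    spectralProjOp y s v = 0 ↔ v ∈ (cutAbove y s).kerᗮ := by
  have : CompleteSpace (cutAbove y s).ker := (cutAbove y s).isClosed_ker.completeSpace_coe
  exact Submodule.starProjection_apply_eq_zero_iff _

theorem reApplyInnerSelf_le_of_spectralProj {y : selfAdjoint M.Elem} {s : ℝ} {v : H}
    (hv : spectralProjOp y s v = v) :
    ((y : M.Elem) : H →L[ℂ] H).reApplyInnerSelf v ≤ s * ‖v‖ ^ 2 := by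
  obtain ⟨b, hb, -, hyb⟩ := exists_cutBelow y s
  rw [spectralProjOp_apply_eq_self_iff] at hv
  rw [reApplyInnerSelf_eq_add_sub_algebraMap _ s, hyb]
  have h1 := (ContinuousLinearMap.isPositive_def'.1
    ((ContinuousLinearMap.nonneg_iff_isPositive _).1 hb)).2 v
  rw [ContinuousLinearMap.reApplyInnerSelf_apply] at h1 ⊢
  rw [sub_apply, hv, zero_sub, inner_neg_left, map_neg]
  linarith

theorem lt_reApplyInnerSelf_of_spectralProj {y : selfAdjoint M.Elem} {s : ℝ} {v : H}
    (hv : spectralProjOp y s v = 0) (hv0 : v ≠ 0) :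
    s * ‖v‖ ^ 2 < ((y : M.Elem) : H →L[ℂ] H).reApplyInnerSelf v := by
  obtain ⟨b, hb, hbc, hyb⟩ := exists_cutBelow y s
  rw [spectralProjOp_apply_eq_zero_iff] at hv
  have hcsa : IsSelfAdjoint (cutAbove y s) := IsSelfAdjoint.of_nonneg (cutAbove_nonneg y s)
  have hbv : b v = 0 := by
    -- `ran b ⊆ ker (y - s)₊` gives `(ker (y - s)₊)ᗮ ⊆ (ran b)ᗮ = ker b`.
    have hcb : cutAbove y s * b = 0 := by
      have := congrArg star hbc
      rwa [star_mul, hcsa.star_eq, (IsSelfAdjoint.of_nonneg hb).star_eq, star_zero] at this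
    have hle : b.range ≤ (cutAbove y s).ker := by
      rintro _ ⟨w, rfl⟩
      exact congrArg (fun T => T w) hcb
    have h1 := Submodule.orthogonal_le hle hv
    rw [ContinuousLinearMap.orthogonal_range, ← ContinuousLinearMap.star_eq_adjoint,
      (IsSelfAdjoint.of_nonneg hb).star_eq] at h1
    exact h1
  have hpos := (ContinuousLinearMap.nonneg_iff_isPositive _).1 (cutAbove_nonneg y s)
  rw [reApplyInnerSelf_eq_add_sub_algebraMap _ s, hyb, lt_add_iff_pos_right,
    ContinuousLinearMap.reApplyInnerSelf_apply, sub_apply, hbv, sub_zero]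
  refine (hpos.re_inner_nonneg_left v).lt_of_ne fun h0 => hv0 ?_
  have : v ∈ (cutAbove y s).ker ⊓ (cutAbove y s).kerᗮ :=
    ⟨apply_eq_zero_of_re_inner_eq_zero (cutAbove_nonneg y s) h0.symm, hv⟩
  rwa [Submodule.inf_orthogonal_eq_bot, Submodule.mem_bot] at this

/-! ### Spectral scale and singular numbers -/

theorem inner_star_apply_self (T : H →L[ℂ] H) (v : H) :
    inner ℂ (star T v) v = starRingEnd ℂ (inner ℂ (T v) v) := by
  rw [ContinuousLinearMap.star_eq_adjoint, ContinuousLinearMap.adjoint_inner_left,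
    inner_conj_symm]

theorem abs_reApplyInnerSelf_realPart_le (x : M.Elem) (v : H) :
    |(((ℜ x : selfAdjoint M.Elem) : M.Elem) : H →L[ℂ] H).reApplyInnerSelf v| ≤
      ‖(x : H →L[ℂ] H) v‖ * ‖v‖ := by
  have h : (((ℜ x : selfAdjoint M.Elem) : M.Elem) : H →L[ℂ] H).reApplyInnerSelf v =
      (inner ℂ ((x : H →L[ℂ] H) v) v).re := by
    have h1 : (((ℜ x : selfAdjoint M.Elem) : M.Elem) : H →L[ℂ] H) =
        (2 : ℂ)⁻¹ • ((x : H →L[ℂ] H) + star (x : H →L[ℂ] H)) := by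
      rw [realPart_apply_coe, ← Complex.coe_smul]
      norm_num
    rw [ContinuousLinearMap.reApplyInnerSelf_apply, h1]
    simp only [smul_apply, add_apply, inner_smul_left, inner_add_left, inner_star_apply_self]
    simp [-inner_conj_symm]
    ring
  rw [h]
  exact (Complex.abs_re_le_norm _).trans (norm_inner_le_norm _ _)

theorem abs_reApplyInnerSelf_imaginaryPart_le (x : M.Elem) (v : H) :
    |(((ℑ x : selfAdjoint M.Elem) : M.Elem) : H →L[ℂ] H).reApplyInnerSelf v| ≤
      ‖(x : H →L[ℂ] H) v‖ * ‖v‖ := by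
  -- The inner product is conjugate-linear in its first argument, whence the sign.
  have h : (((ℑ x : selfAdjoint M.Elem) : M.Elem) : H →L[ℂ] H).reApplyInnerSelf v =
      -(inner ℂ ((x : H →L[ℂ] H) v) v).im := by
    have h1 : (((ℑ x : selfAdjoint M.Elem) : M.Elem) : H →L[ℂ] H) =
        -Complex.I • (2 : ℂ)⁻¹ • ((x : H →L[ℂ] H) - star (x : H →L[ℂ] H)) := by
      rw [imaginaryPart_apply_coe, ← Complex.coe_smul]
      norm_num
    rw [ContinuousLinearMap.reApplyInnerSelf_apply, h1]
    simp only [smul_apply, sub_apply, inner_smul_left, inner_sub_left, inner_star_apply_self]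
    simp [-inner_conj_symm]
    ring
  rw [h, abs_neg]
  exact (Complex.abs_im_le_norm _).trans (norm_inner_le_norm _ _)

variable {τ : M.Weight}

theorem norm_apply_le_of_proj (x : M.Elem) (e : M.Proj) {v : H}
    (hv : (e.1 : H →L[ℂ] H) v = v) : ‖(x : H →L[ℂ] H) v‖ ≤ ‖x * e.1‖ * ‖v‖ := by
  have h := ((x * e.1 : M.Elem) : H →L[ℂ] H).le_opNorm v
  have h1 : ((x * e.1 : M.Elem) : H →L[ℂ] H) v = (x : H →L[ℂ] H) v :=
    congrArg (x : H →L[ℂ] H) hv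
  rwa [h1] at h

theorem orth_apply_eq_self_iff (e : M.Proj) (v : H) :
    (e.orth.1 : H →L[ℂ] H) v = v ↔ (e.1 : H →L[ℂ] H) v = 0 :=
  sub_eq_self

theorem orth_apply_eq_zero_iff (e : M.Proj) (v : H) :
    (e.orth.1 : H →L[ℂ] H) v = 0 ↔ (e.1 : H →L[ℂ] H) v = v :=
  sub_eq_zero.trans eq_comm

/-- On the range of `1 - e_r(y)`, where `r = ‖x e‖`, the form of `y` exceeds `r`; on the range of
`e` it does not. -/
theorem compl_spectralProj_le_compl (hτ : τ.IsFaithfulNormalTracialState) {x : M.Elem}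
    {y : selfAdjoint M.Elem} (hxy : ∀ v : H, |((y : M.Elem) : H →L[ℂ] H).reApplyInnerSelf v| ≤
      ‖(x : H →L[ℂ] H) v‖ * ‖v‖) (e : M.Proj) :
    τ (spectralProj y ‖x * e.1‖).compl ≤ τ e.compl := by
  rw [← Proj.toPos_orth, ← Proj.toPos_orth]
  refine Weight.toPos_le_toPos_of_ker hτ.normal hτ.tracial _ _ fun v hp hq => ?_
  rw [orth_apply_eq_self_iff] at hp
  rw [orth_apply_eq_zero_iff] at hq
  by_contra hv0
  have h1 := lt_reApplyInnerSelf_of_spectralProj hp hv0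
  have h2 := (le_abs_self _).trans (hxy v)
  nlinarith [norm_apply_le_of_proj x e hq, norm_nonneg v]

/-- For `r < -‖x e‖` the form of `y` is at most `r` on the range of `e_r(y)`, but not on the range
of `e`. -/
theorem spectralProj_le_compl (hτ : τ.IsFaithfulNormalTracialState) {x : M.Elem}
    {y : selfAdjoint M.Elem} (hxy : ∀ v : H, |((y : M.Elem) : H →L[ℂ] H).reApplyInnerSelf v| ≤
      ‖(x : H →L[ℂ] H) v‖ * ‖v‖) (e : M.Proj) {r : ℝ} (hr : r < -‖x * e.1‖) :
    τ (spectralProj y r).toPos ≤ τ e.compl := by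
  rw [← Proj.toPos_orth]
  refine Weight.toPos_le_toPos_of_ker hτ.normal hτ.tracial _ _ fun v hp hq => ?_
  rw [orth_apply_eq_zero_iff] at hq
  by_contra hv0
  have h1 := reApplyInnerSelf_le_of_spectralProj hp
  have h2 := (neg_le_abs _).trans (hxy v)
  have h3 : 0 < ‖v‖ := norm_pos_iff.2 hv0
  have h4 := mul_le_mul_of_nonneg_right (norm_apply_le_of_proj x e hq) h3.le
  nlinarith [mul_lt_mul_of_pos_right hr (pow_pos h3 2)]

/-- Both bounds for the spectral scale of a self-adjoint `y` use only that the quadratic form of `y`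
is dominated by `‖x v‖ ‖v‖`, which holds for the real and for the imaginary part of `x`. -/
theorem spectralScale_bounds (hτ : τ.IsFaithfulNormalTracialState) {x : M.Elem}
    {y : selfAdjoint M.Elem} (hxy : ∀ v : H, |((y : M.Elem) : H →L[ℂ] H).reApplyInnerSelf v| ≤
      ‖(x : H →L[ℂ] H) v‖ * ‖v‖) {s : ℝ} (hs0 : 0 < s) (hs1 : s < 1) :
    -singularNumberLeft τ (1 - s) x ≤ spectralScale τ s y ∧
      spectralScale τ s y ≤ singularNumber τ s x := by
  have hone := Weight.compl_one hτ
  have hlower : ∀ r : ℝ, τ (spectralProj y r).compl ≤ ENNReal.ofReal s →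
      ∀ e : M.Proj, τ e.compl < ENNReal.ofReal (1 - s) → -‖x * e.1‖ ≤ r := by
    intro r hr e he
    by_contra! hlt
    have h1 := (spectralProj_le_compl hτ hxy e hlt).trans_lt he
    have h2 := ENNReal.add_lt_add_of_lt_of_le (hr.trans_lt ENNReal.ofReal_lt_top).ne h1 hr
    rw [Weight.toPos_add_compl hτ, ← ENNReal.ofReal_add (sub_pos.2 hs1).le hs0.le,
      sub_add_cancel, ENNReal.ofReal_one] at h2
    exact h2.false
  have hupper : ∀ e : M.Proj, τ e.compl ≤ ENNReal.ofReal s →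
      τ (spectralProj y ‖x * e.1‖).compl ≤ ENNReal.ofReal s :=
    fun e he => (compl_spectralProj_le_compl hτ hxy e).trans he
  have hs : τ (Proj.compl (⟨1, IsStarProjection.one M.Elem⟩ : M.Proj)) ≤ ENNReal.ofReal s :=
    hone.le.trans zero_le
  have hs' : τ (Proj.compl (⟨1, IsStarProjection.one M.Elem⟩ : M.Proj)) <
      ENNReal.ofReal (1 - s) := hone.trans_lt (ENNReal.ofReal_pos.2 (sub_pos.2 hs1))
  -- The infima are over nonempty sets, as `e = 1` is admissible and `hupper` applies to it, and
  -- `hlower` bounds the set defining the spectral scale from below.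
  constructor
  · refine le_csInf ⟨_, hupper _ hs⟩ fun r hr => neg_le.1 ?_
    refine le_csInf ⟨_, _, hs', rfl⟩ ?_
    rintro _ ⟨e, he, rfl⟩
    exact neg_le.1 (hlower r hr e he)
  · refine le_csInf ⟨_, _, hs, rfl⟩ ?_
    rintro _ ⟨e, he, rfl⟩
    exact csInf_le ⟨_, fun r hr => hlower r hr _ hs'⟩ (hupper e he)

end VonNeumannAlgebra

theorem mainTheorem8 {H : Type*} [NormedAddCommGroup H] [InnerProductSpace ℂ H]
    [CompleteSpace H] [TopologicalSpace.SeparableSpace H] (M : VonNeumannAlgebra H)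
    (τ : M.Weight) (hτ : τ.IsFaithfulNormalTracialState)
    (x : M.Elem) (s : ℝ) (hs0 : 0 < s) (hs1 : s < 1) :
    (-VonNeumannAlgebra.singularNumberLeft τ (1 - s) x
          ≤ VonNeumannAlgebra.spectralScale τ s (ℜ x) ∧
      VonNeumannAlgebra.spectralScale τ s (ℜ x) ≤ VonNeumannAlgebra.singularNumber τ s x) ∧
    (-VonNeumannAlgebra.singularNumberLeft τ (1 - s) x
          ≤ VonNeumannAlgebra.spectralScale τ s (ℑ x) ∧
      VonNeumannAlgebra.spectralScale τ s (ℑ x) ≤ VonNeumannAlgebra.singularNumber τ s x) :=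
  ⟨VonNeumannAlgebra.spectralScale_bounds hτ
      (VonNeumannAlgebra.abs_reApplyInnerSelf_realPart_le x) hs0 hs1,
    VonNeumannAlgebra.spectralScale_bounds hτ
      (VonNeumannAlgebra.abs_reApplyInnerSelf_imaginaryPart_le x) hs0 hs1⟩
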